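/- Let $\mathbb{W}=\mathbb{C}(\lambda)$, each element being written $p/q$ in lowest terms. Let $G=(V,E,\omega)$ be a finite weighted digraph (loops allowed, no parallel edges) with weights in $\mathbb{W}$, where $\omega(i,j)=0$ if and only if $(i,j)\notin E$. Write $\omega(i,j)=p_{ij}/q_{ij}$. **Cycles.** A strong cycle of $G$ is a tuple of $m\ge 2$ distinct vertices, up to cyclic permutation, each joined by an edge to its cyclic successor. If no strong cycle passes through a vertex $i$, then $\{i\}$ is a weak cycle, whether or not $(i,i)\in E$. Let $C(G)$ be the set of all strong and weak cycles. Let $E^{scc}$ be the set of edges belonging to strongly connected components of $G$. **Regions.** Let $L_i=\prod_{j\in V}q_{ij}$. The polynomial extension $\bar G$ is the graph with vertex set $V$ and weights $M(\bar G,\lambda)_{ij}=L_i\,\omega(i,j)$ for $i\ne j$ and $M(\bar G,\lambda)_{ii}=L_i\,\omega(i,i)-L_i\lambda+\lambda$; these are polynomials in $\lambda$. Let $\tilde r_i(\bar G,\lambda)=\sum_j|M(\bar G,\lambda)_{ij}|$, the sum being over all $j\neq i$ in the strongly connected component of $\bar G$ that contains $i$. The Brualdi-type region of $G$ is $$\mathcal{BW}_B(G)=\bigcup_{\gamma\in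 C(\bar G)}\Big\{\lambda\in\mathbb{C}:\prod_{i\in\gamma}|\lambda-M(\bar G,\lambda)_{ii}|\le\prod_{i\in\gamma}\tilde r_i(\bar G,\lambda)\Big\}.$$ **Reductions.** A nonempty set $S\subseteq V$ is structural if every strong cycle of $G$ meets $S$ and $\omega(i,i)\ne\lambda$ for all $i\in V\setminus S$. For such $S$, the isospectral reduction $\mathcal{R}_S(G)$ is the graph with vertex set $S$ in which the weight of $(i,j)$ is $$\sum_{\beta}\omega(b_1,b_2)\prod_{k=2}^{m-1}\frac{\omega(b_k,b_{k+1})}{\lambda-\omega(b_k,b_k)},$$ the sum being over all paths (cycles, if $i=j$) $\beta=b_1,\dots,b_m$ in $G$, $m\geq 2$, with $b_1=i$ and $b_m=j$, whose interior vertices $b_2,\dots,b_{m-1}$ are distinct and lie outside $S$. **Conditions at a vertex.** For $v\in V$ let $C(v,G)$ be the set of $\gamma\in C(G)$ that pass through $v$. Let $\mathcal{A}(v,G)$ be the set of $\gamma\in C(G)$ that do not pass through $v$ and contain a vertex $j$ with $(j,v)\in E^{scc}$. Let $\mathcal{S}(v,G)\subseteq C(v,G)$ consist of the one-vertex cycle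 $\{v\}$, if it is in $C(G)$, and of all cycles $(a_1,a_2,\dots,a_m)\in C(v,G)$ with $a_1=v$ and $m\ge2$ such that $(a_j,v)\notin E$ for $1<j<m$ and $(a_m,k)\notin E^{scc}$ for every vertex $k$ not on the cycle. **Theorem (Improved Brualdi Regions).** Let $G=(V,E,\omega)$ be as above with $\deg p_{ij}\le\deg q_{ij}$ for every nonzero weight (that is, $G\in\mathbb{G}_\pi$), and suppose that $V$ contains at least two vertices. Let $v\in V$ be such that $\mathcal{A}(v,G)=\emptyset$ and $C(v,G)=\mathcal{S}(v,G)$. Then $V\setminus\{v\}$ is a structural set of $G$, so that $\mathcal{R}_{V\setminus\{v\}}(G)$ is defined, and $$\mathcal{BW}_B\big(\mathcal{R}_{V\setminus\{v\}}(G)\big)\subseteq\mathcal{BW}_B(G).$$ -/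

import Mathlib

noncomputable section

/-- A weighted digraph with vertex set `V`, possibly with loops, without parallel edges, whose
edge weights are complex rational functions in one variable.  An ordered pair of vertices is an
edge exactly if its weight is nonzero, so the graph is given by its weight function. -/
@[ext]
structure WeightedDigraph (V : Type*) where
  /-- `weight i j` is the weight of the edge from `i` to `j`, which is the `(i, j)` entry of the
  weighted adjacency matrix; it is `0` if there is no such edge. -/
  weight : V → V → RatFunc ℂ

namespace WeightedDigraph

variable {V : Type*} (G : WeightedDigraph V)

/-- `G.Edge i j`: the pair `(i, j)` is an edge of `G`. -/
def Edge (i j : V) : Prop := G.weight i j ≠ 0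

/-- The graphs all of whose weights `p / q` satisfy `deg p ≤ deg q`. -/
def InGPi : Prop := ∀ i j, (G.weight i j).intDegree ≤ 0

/-! ### Cycles and strongly connected components -/

/-- Strong cycles: cyclically ordered tuples of `m ≥ 2` distinct vertices, each of which is joined
by an edge to its successor (the last one to the first one). -/
def strongCycles : Set (Cycle V) := {γ | γ.Nodup ∧ γ.Chain G.Edge ∧ 2 ≤ γ.length}

/-- Weak cycles: the one-vertex cycles `{i}` for the vertices `i` that lie on no strong cycle,
whether or not there is a loop at `i`. -/
def weakCycles : Set (Cycle V) :=
  {γ | ∃ i : V, γ = (([i] : List V) : Cycle V) ∧ ∀ δ ∈ G.strongCycles, i ∉ δ}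

/-- The cycle set of the graph: all strong cycles and all weak cycles. -/
def cycleSet : Set (Cycle V) := G.strongCycles ∪ G.weakCycles

/-- Two vertices are in the same strongly connected component: each can be reached from the other
along a path, possibly of length zero. -/
def SameComponent (i j : V) : Prop :=
  Relation.ReflTransGen G.Edge i j ∧ Relation.ReflTransGen G.Edge j i

/-- Edges that belong to some strongly connected component. -/
def ComponentEdge (i j : V) : Prop := G.Edge i j ∧ G.SameComponent i j

/-- The cycles that avoid `v` and contain a vertex `j` such that `(j, v)` is an edge of a strongly
connected component. -/
def adjacentCycles (v : V) : Set (Cycle V) :=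
  {γ | γ ∈ G.cycleSet ∧ v ∉ γ ∧ ∃ j ∈ γ, G.ComponentEdge j v}

/-- The cycles through `v`. -/
def cyclesThrough (v : V) : Set (Cycle V) := {γ | γ ∈ G.cycleSet ∧ v ∈ γ}

/-- The special cycles through `v`.  A cycle through `v` with at least two vertices is written as
`v, a₂, …, aₘ₋₁, w`.  It is special if none of `a₂, …, aₘ₋₁` has an edge to `v` and no edge from
`w` to a vertex outside the cycle belongs to a strongly connected component.  A one-vertex cycle
through `v` is always special. -/
def specialCycles (v : V) : Set (Cycle V) :=
  {γ | γ ∈ G.cyclesThrough v ∧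
    ∀ (a : List V) (w : V), γ = ((v :: (a ++ [w]) : List V) : Cycle V) →
      (∀ x ∈ a, ¬ G.Edge x v) ∧ ∀ k, k ∉ γ → ¬ G.ComponentEdge w k}

/-! ### Brualdi-type regions -/

section Region

variable [Fintype V]

/-- `L_i`, the product over `j` of the denominators of the weights of the edges from `i` to `j`
(written in lowest terms). -/
def rowDenom (i : V) : Polynomial ℂ := ∏ j, (G.weight i j).denom

open Classical in
/-- The polynomial extension of `G`: the weight of `(i, j)` is multiplied by `L_i`, and on the
diagonal `λ - L_i λ` is added. -/
def polyExt : WeightedDigraph V where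
  weight i j :=
    if i = j then
      algebraMap (Polynomial ℂ) (RatFunc ℂ) (G.rowDenom i) * G.weight i j
        - algebraMap (Polynomial ℂ) (RatFunc ℂ) (G.rowDenom i) * RatFunc.X + RatFunc.X
    else algebraMap (Polynomial ℂ) (RatFunc ℂ) (G.rowDenom i) * G.weight i j

/-- The weights of the polynomial extension are polynomials; so they have a value everywhere. -/
theorem polyExt_weight_polynomial (i j : V) :
    ∃ p : Polynomial ℂ, G.polyExt.weight i j = algebraMap (Polynomial ℂ) (RatFunc ℂ) p := by
  classical
  have key : algebraMap (Polynomial ℂ) (RatFunc ℂ) (G.rowDenom i) * G.weight i j =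
      algebraMap (Polynomial ℂ) (RatFunc ℂ)
        ((∏ k ∈ Finset.univ.erase j, (G.weight i k).denom) * (G.weight i j).num) := by
    have h0 : algebraMap (Polynomial ℂ) (RatFunc ℂ) (G.weight i j).denom ≠ 0 :=
      RatFunc.algebraMap_ne_zero (RatFunc.denom_ne_zero _)
    have h1 : G.rowDenom i =
        (∏ k ∈ Finset.univ.erase j, (G.weight i k).denom) * (G.weight i j).denom :=
      (Finset.prod_erase_mul _ _ (Finset.mem_univ j)).symm
    rw [h1, map_mul, map_mul, mul_assoc]
    congr 1
    rw [mul_comm]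
    exact ((div_eq_iff h0).1 (RatFunc.num_div_denom (G.weight i j))).symm
  by_cases h : i = j
  · refine ⟨(∏ k ∈ Finset.univ.erase j, (G.weight i k).denom) * (G.weight i j).num
      - G.rowDenom i * Polynomial.X + Polynomial.X, ?_⟩
    simp only [polyExt, if_pos h, key, map_add, map_sub, map_mul, RatFunc.algebraMap_X]
  · exact ⟨_, by simp only [polyExt, if_neg h]; exact key⟩

/-- The value at `z` of the weight of the edge from `i` to `j`. -/
def weightAt (z : ℂ) (i j : V) : ℂ := (G.weight i j).eval (RingHom.id ℂ) z

open Classical in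
/-- The `i`-th row sum of absolute values of the off-diagonal weights at `z`, restricted to the
strongly connected component of `i`. -/
def componentRowSum (z : ℂ) (i : V) : ℝ :=
  ∑ j with j ≠ i ∧ G.SameComponent i j, ‖G.weightAt z i j‖

open Classical in
/-- The Brualdi-type region associated with the cycle `γ`. -/
def brualdiRegionOf (γ : Cycle V) : Set ℂ :=
  {z | ∏ i ∈ γ.toFinset, ‖z - G.polyExt.weightAt z i i‖ ≤
    ∏ i ∈ γ.toFinset, G.polyExt.componentRowSum z i}

/-- The Brualdi-type region of `G`. -/
def brualdiRegion : Set ℂ := ⋃ γ ∈ G.polyExt.cycleSet, G.brualdiRegionOf γ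

end Region

/-! ### Isospectral reductions -/

/-- Structural sets: nonempty vertex sets `S` whose complement induces no cycle once loops are
removed (the cycles of the graph without its loops are exactly the strong cycles), and such that
no vertex outside `S` has a loop of weight `λ`. -/
def IsStructuralSet (S : Finset V) : Prop :=
  S.Nonempty ∧ (∀ γ ∈ G.strongCycles, ∃ x ∈ γ, x ∈ S) ∧ ∀ i, i ∉ S → G.weight i i ≠ RatFunc.X

/-- Branches from `i` to `j` with respect to `S`, for `i` and `j` in `S`: the paths (cycles, if
`i = j`) from `i` to `j` with no interior vertex in `S`, as vertex sequences.  Since `i` and `j`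
are in `S` and the interior vertices are not, only the latter have to be required distinct. -/
def branches (S : Finset V) (i j : S) : Set (List V) :=
  {β | ∃ l : List V, β = (i : V) :: (l ++ [(j : V)]) ∧ l.Nodup ∧ (∀ x ∈ l, x ∉ S) ∧
    β.IsChain G.Edge}

theorem branches_finite [Finite V] (S : Finset V) (i j : S) : (G.branches S i j).Finite := by
  classical
  have := Fintype.ofFinite V
  refine (Set.finite_range
    (fun l : {l : List V // l.Nodup} => (i : V) :: (l.1 ++ [(j : V)]))).subset ?_
  rintro β ⟨l, rfl, hl, -, -⟩
  exact ⟨⟨l, hl⟩, rfl⟩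

/-- For a sequence `b₂, …, bₘ` the product over `2 ≤ k < m` of
`ω(bₖ, bₖ₊₁) / (λ - ω(bₖ, bₖ))`. -/
def interiorProduct : List V → RatFunc ℂ
  | [] => 1
  | [_] => 1
  | a :: b :: l => G.weight a b / (RatFunc.X - G.weight a a) * interiorProduct (b :: l)

/-- The branch product of `b₁, …, bₘ` with `m ≥ 2`: the weight of `(b₁, b₂)` times the product over
`2 ≤ k < m` of `ω(bₖ, bₖ₊₁) / (λ - ω(bₖ, bₖ))`.  Shorter sequences are no branches. -/
def branchProduct : List V → RatFunc ℂ
  | a :: b :: l => G.weight a b * G.interiorProduct (b :: l)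
  | _ => 0

/-- The isospectral reduction of `G` over `S`: the graph with vertex set `S` in which the weight of
`(i, j)` is the (finite) sum of the branch products of all branches from `i` to `j`. -/
def reduction (S : Finset V) : WeightedDigraph S where
  weight i j := ∑ᶠ β ∈ G.branches S i j, G.branchProduct β

end WeightedDigraph

end

/-! Fix `z` outside the region of `G`. No factor `z - M(Ḡ, z)ᵢᵢ` vanishes, so at `z` the
off-diagonal weights and the reciprocals of `λ - ω(i, i)` have no poles. Put `b i j = ω(i, j) / (λ -
ω(i, i))`, evaluated at `z`, and let `ρ i` be the sum of `|b i j|` over `j ≠ i` in the component of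
`i`. Dividing out the nonzero factors, `z` lies in the region exactly if some strong cycle has `∏ ρ
i ≥ 1` (`HasValuesAt.mem_brualdiRegion_iff`). This criterion no longer mentions lowest terms, so it
applies equally to the reduction, whose polynomial extension never has to be computed.

Removing `v` turns `b` into `(b i j + b i v * b v j) / (1 - b i v * b v i)`, with row sums `ρ'`. Two
estimates carry the proof: `ρ' i ≤ ρ i` if `(i, v)` is not a component edge, and `ρ' i ≤ ρ i * ρ v`
if it is the only component edge leaving `i` apart from a loop.

Take a strong cycle of the reduction. If all its edges are edges of `G`, it is a strong cycle
avoiding `v`; as no such cycle is adjacent to `v`, the first estimate applies throughout. Otherwise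
cut it at the edges that exist only as detours through `v`. Each piece closes up through `v` to a
strong cycle of `G`, which is special: its last vertex takes the second estimate and all others the
first. So the product of `ρ'` over a piece is at most the product of `ρ` over a strong cycle, which
is less than `1`. -/

noncomputable section

/-! ### Values of rational functions at a point, compatible with arithmetic -/

/-- `HasValueAt f z c`: the rational function `f` has no pole at `z` and takes the value `c`
there. -/
def HasValueAt (f : RatFunc ℂ) (z c : ℂ) : Prop :=
  ∃ p q : Polynomial ℂ, q.eval z ≠ 0 ∧
    f = algebraMap (Polynomial ℂ) (RatFunc ℂ) p / algebraMap (Polynomial ℂ) (RatFunc ℂ) q ∧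
    c = p.eval z / q.eval z

namespace HasValueAt

variable {f g : RatFunc ℂ} {z c d : ℂ}

theorem algebraMap_ne_zero_of_eval {q : Polynomial ℂ} (hq : q.eval z ≠ 0) :
    algebraMap (Polynomial ℂ) (RatFunc ℂ) q ≠ 0 :=
  RatFunc.algebraMap_ne_zero (by rintro rfl; simp at hq)

theorem add (hf : HasValueAt f z c) (hg : HasValueAt g z d) : HasValueAt (f + g) z (c + d) := by
  obtain ⟨p, q, hq, rfl, rfl⟩ := hf
  obtain ⟨p', q', hq', rfl, rfl⟩ := hg
  refine ⟨p * q' + q * p', q * q', by simp [hq, hq'], ?_, ?_⟩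
  · rw [div_add_div _ _ (algebraMap_ne_zero_of_eval hq) (algebraMap_ne_zero_of_eval hq')]
    simp
  · rw [div_add_div _ _ hq hq']
    simp

theorem mul (hf : HasValueAt f z c) (hg : HasValueAt g z d) : HasValueAt (f * g) z (c * d) := by
  obtain ⟨p, q, hq, rfl, rfl⟩ := hf
  obtain ⟨p', q', hq', rfl, rfl⟩ := hg
  refine ⟨p * p', q * q', by simp [hq, hq'], ?_, ?_⟩
  · simp [div_mul_div_comm]
  · simp [div_mul_div_comm]

theorem one : HasValueAt 1 z 1 := ⟨1, 1, by simp, by simp, by simp⟩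

theorem neg (hf : HasValueAt f z c) : HasValueAt (-f) z (-c) := by
  obtain ⟨p, q, hq, rfl, rfl⟩ := hf
  exact ⟨-p, q, hq, by rw [map_neg]; exact (neg_div _ _).symm,
    by rw [Polynomial.eval_neg, neg_div]⟩

theorem sub (hf : HasValueAt f z c) (hg : HasValueAt g z d) : HasValueAt (f - g) z (c - d) := by
  simpa [sub_eq_add_neg] using hf.add hg.neg

theorem inv (hf : HasValueAt f z c) (hc : c ≠ 0) : HasValueAt f⁻¹ z c⁻¹ := by
  obtain ⟨p, q, hq, rfl, rfl⟩ := hf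
  exact ⟨q, p, fun h => hc (by simp [h]), by simp, by simp⟩

theorem ne_zero (hf : HasValueAt f z c) (hc : c ≠ 0) : f ≠ 0 := by
  obtain ⟨p, q, hq, rfl, rfl⟩ := hf
  have hp : p.eval z ≠ 0 := fun h => hc (by simp [h])
  exact div_ne_zero (algebraMap_ne_zero_of_eval hp) (algebraMap_ne_zero_of_eval hq)

theorem of_denom (h : f.denom.eval z ≠ 0) : HasValueAt f z (f.num.eval z / f.denom.eval z) :=
  ⟨f.num, f.denom, h, (RatFunc.num_div_denom f).symm, rfl⟩

/-- A quotient of coprime polynomials has a value only where its denominator does not vanish. -/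
theorem of_isCoprime {p q : Polynomial ℂ} (hq : q ≠ 0) (hpq : IsCoprime p q)
    (h : HasValueAt (algebraMap (Polynomial ℂ) (RatFunc ℂ) p /
      algebraMap (Polynomial ℂ) (RatFunc ℂ) q) z c) :
    q.eval z ≠ 0 ∧ c = p.eval z / q.eval z := by
  obtain ⟨P, Q, hQ, he, rfl⟩ := h
  rw [div_eq_div_iff (RatFunc.algebraMap_ne_zero hq) (algebraMap_ne_zero_of_eval hQ),
    ← map_mul, ← map_mul] at he
  have he' : p * Q = P * q := RatFunc.algebraMap_injective ℂ he
  have hdvd : q ∣ Q := hpq.symm.dvd_of_dvd_mul_left ⟨P, by rw [he']; ring⟩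
  have hq' : q.eval z ≠ 0 := by
    obtain ⟨R, rfl⟩ := hdvd
    intro h0
    simp [h0] at hQ
  refine ⟨hq', ?_⟩
  rw [div_eq_div_iff hQ hq', ← Polynomial.eval_mul, ← Polynomial.eval_mul, he']

theorem denom_eval (h : HasValueAt f z c) :
    f.denom.eval z ≠ 0 ∧ c = f.num.eval z / f.denom.eval z := by
  rw [← RatFunc.num_div_denom f] at h
  exact of_isCoprime (RatFunc.denom_ne_zero f) (RatFunc.isCoprime_num_denom f) h

theorem eq_zero (h : HasValueAt 0 z c) : c = 0 := by
  simpa using h.denom_eval.2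

end HasValueAt

/-! ### Values of the polynomial extension -/

namespace WeightedDigraph

variable {V : Type*} (G : WeightedDigraph V)

/-- The numerator `λ q - p` of `λ - ω(i, i)`, where `ω(i, i) = p / q` in lowest terms. -/
def diagNum (i : V) : Polynomial ℂ :=
  Polynomial.X * (G.weight i i).denom - (G.weight i i).num

theorem X_sub_weight (i : V) : RatFunc.X - G.weight i i =
    algebraMap (Polynomial ℂ) (RatFunc ℂ) (G.diagNum i) /
      algebraMap (Polynomial ℂ) (RatFunc ℂ) (G.weight i i).denom := by
  have h := RatFunc.algebraMap_ne_zero (RatFunc.denom_ne_zero (G.weight i i))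
  rw [eq_div_iff h, sub_mul, diagNum, map_sub, map_mul, RatFunc.algebraMap_X]
  congr 1
  exact (div_eq_iff h).1 (RatFunc.num_div_denom (G.weight i i)) |>.symm

/-- With `ω(i, i) = p / q`, this makes `q / (λ q - p)` a lowest-terms form of the reciprocal of `λ -
ω(i, i)`. The reciprocal can have a value, namely `0`, where `ω(i, i)` itself has a pole. -/
theorem isCoprime_denom_diagNum (i : V) : IsCoprime (G.weight i i).denom (G.diagNum i) := by
  have h := (RatFunc.isCoprime_num_denom (G.weight i i)).symm.neg_right
  simpa [diagNum, sub_eq_add_neg, add_comm] using h.add_mul_left_right Polynomial.X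

theorem hasValueAt_inv_X_sub_weight {z : ℂ} {i : V} (h : (G.diagNum i).eval z ≠ 0) :
    HasValueAt (RatFunc.X - G.weight i i)⁻¹ z
      ((G.weight i i).denom.eval z / (G.diagNum i).eval z) :=
  ⟨_, _, h, by rw [X_sub_weight, inv_div], rfl⟩

theorem diagNum_eval_of_hasValueAt {z c : ℂ} {i : V} (h0 : RatFunc.X - G.weight i i ≠ 0)
    (h : HasValueAt (RatFunc.X - G.weight i i)⁻¹ z c) :
    (G.diagNum i).eval z ≠ 0 ∧ c = (G.weight i i).denom.eval z / (G.diagNum i).eval z := by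
  rw [X_sub_weight, inv_div] at h
  refine HasValueAt.of_isCoprime ?_ (G.isCoprime_denom_diagNum i) h
  intro hd
  rw [X_sub_weight, hd] at h0
  simp at h0

section Finite

variable [Fintype V]

open Classical in
/-- The product of the denominators of the weights of the edges from `i` to vertices other
than `j`. -/
def rowDenomErase (i j : V) : Polynomial ℂ :=
  ∏ k ∈ Finset.univ.erase j, (G.weight i k).denom

theorem rowDenom_mul_weight (i j : V) :
    algebraMap (Polynomial ℂ) (RatFunc ℂ) (G.rowDenom i) * G.weight i j =
      algebraMap (Polynomial ℂ) (RatFunc ℂ) (G.rowDenomErase i j * (G.weight i j).num) := by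
  classical
  have h0 : algebraMap (Polynomial ℂ) (RatFunc ℂ) (G.weight i j).denom ≠ 0 :=
    RatFunc.algebraMap_ne_zero (RatFunc.denom_ne_zero _)
  have h1 : G.rowDenom i = G.rowDenomErase i j * (G.weight i j).denom :=
    (Finset.prod_erase_mul _ _ (Finset.mem_univ j)).symm
  rw [h1, map_mul, map_mul, mul_assoc]
  congr 1
  rw [mul_comm]
  exact ((div_eq_iff h0).1 (RatFunc.num_div_denom (G.weight i j))).symm

/-- By definition `λ - M(Ḡ, λ)ᵢᵢ = Lᵢ (λ - ω(i, i))`, and one factor of `Lᵢ` cancels the denominator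
of `ω(i, i)`. Nonvanishing at `z` therefore excludes poles both of the reciprocal and of the
off-diagonal weights in row `i`. -/
theorem sub_polyExt_weightAt_self (z : ℂ) (i : V) :
    z - G.polyExt.weightAt z i i = (G.diagNum i).eval z * (G.rowDenomErase i i).eval z := by
  classical
  have h1 : G.rowDenom i = G.rowDenomErase i i * (G.weight i i).denom :=
    (Finset.prod_erase_mul _ _ (Finset.mem_univ i)).symm
  have h : G.polyExt.weight i i = algebraMap (Polynomial ℂ) (RatFunc ℂ)
      (Polynomial.X - G.diagNum i * G.rowDenomErase i i) := by
    simp only [polyExt, if_true, rowDenom_mul_weight, ← RatFunc.algebraMap_X, ← map_mul, ← map_sub,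
      ← map_add]
    congr 1
    rw [h1, diagNum]
    ring
  rw [weightAt, h, RatFunc.eval_algebraMap]
  simp [Polynomial.eval₂_id]

theorem polyExt_weightAt_of_ne (z : ℂ) {i j : V} (hij : i ≠ j) :
    G.polyExt.weightAt z i j = (G.rowDenomErase i j).eval z * (G.weight i j).num.eval z := by
  have h : G.polyExt.weight i j = algebraMap (Polynomial ℂ) (RatFunc ℂ)
      (G.rowDenomErase i j * (G.weight i j).num) := by
    simp only [polyExt, if_neg hij, rowDenom_mul_weight]
  rw [weightAt, h, RatFunc.eval_algebraMap]
  simp [Polynomial.eval₂_id]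

theorem eval_rowDenomErase_ne_zero {z : ℂ} {i : V} :
    (G.rowDenomErase i i).eval z ≠ 0 ↔ ∀ j, j ≠ i → (G.weight i j).denom.eval z ≠ 0 := by
  classical
  simp [rowDenomErase, Polynomial.eval_prod, Finset.prod_eq_zero_iff]

/-- Where the off-diagonal weights have values, the off-diagonal weights of the polynomial
extension are proportional to them. -/
theorem polyExt_weightAt_eq_mul {z u c : ℂ} {i j : V} (hij : i ≠ j)
    (h0 : RatFunc.X - G.weight i i ≠ 0) (hu : HasValueAt (RatFunc.X - G.weight i i)⁻¹ z u)
    (hc : HasValueAt (G.weight i j) z c) :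
    G.polyExt.weightAt z i j = (z - G.polyExt.weightAt z i i) * (u * c) := by
  classical
  obtain ⟨hd, rfl⟩ := G.diagNum_eval_of_hasValueAt h0 hu
  obtain ⟨hq, rfl⟩ := hc.denom_eval
  rw [sub_polyExt_weightAt_self, polyExt_weightAt_of_ne _ _ hij]
  have h : G.rowDenomErase i j * (G.weight i j).denom =
      G.rowDenomErase i i * (G.weight i i).denom := by
    simp only [rowDenomErase]
    rw [Finset.prod_erase_mul _ _ (Finset.mem_univ _),
      Finset.prod_erase_mul _ _ (Finset.mem_univ _)]
  have h' := congrArg (Polynomial.eval z) h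
  simp only [Polynomial.eval_mul] at h'
  field_simp
  linear_combination (Polynomial.eval z (G.weight i j).num) * h'

theorem polyExt_edge_iff {i j : V} (hij : i ≠ j) : G.polyExt.Edge i j ↔ G.Edge i j := by
  have h : algebraMap (Polynomial ℂ) (RatFunc ℂ) (G.rowDenom i) ≠ 0 :=
    RatFunc.algebraMap_ne_zero (Finset.prod_ne_zero_iff.2 fun j _ => RatFunc.denom_ne_zero _)
  simp only [Edge, polyExt, if_neg hij]
  simp [h]

end Finite

end WeightedDigraph

/-! ### Paths, strong cycles and components -/

theorem Relation.ReflTransGen.exists_nodup_isChain {α : Type*} {r : α → α → Prop} {a b : α}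
    (h : Relation.ReflTransGen r a b) (hab : a ≠ b) :
    ∃ l : List α, (a :: (l ++ [b])).Nodup ∧ (a :: (l ++ [b])).IsChain r := by
  induction h using Relation.ReflTransGen.head_induction_on with
  | refl => exact absurd rfl hab
  | @head a c hac _ ih =>
    by_cases hcb : c = b
    · subst hcb
      exact ⟨[], by simpa using hab, by simpa using hac⟩
    · obtain ⟨l, hl, hc⟩ := ih hcb
      -- If the new head already lies on the path, everything before that occurrence is dropped.
      by_cases ha : a ∈ c :: l
      · obtain ⟨s, t, hst⟩ := List.append_of_mem ha
        have he : c :: (l ++ [b]) = s ++ (a :: (t ++ [b])) := by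
          rw [← List.cons_append, hst]
          simp
        rw [he] at hl hc
        exact ⟨t, (List.nodup_append.1 hl).2.1, hc.right_of_append⟩
      · refine ⟨c :: l, ?_, ?_⟩
        · rw [List.cons_append, List.nodup_cons]
          refine ⟨fun h => ?_, hl⟩
          rw [← List.cons_append, List.mem_append] at h
          simp only [List.mem_singleton] at h
          exact h.elim ha hab
        · exact List.IsChain.cons_cons hac hc

theorem Relation.ReflTransGen.of_forall_ne {α : Type*} {r s : α → α → Prop}
    (hrs : ∀ a b, a ≠ b → r a b → s a b) {a b : α} (h : Relation.ReflTransGen r a b) :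
    Relation.ReflTransGen s a b := by
  induction h with
  | refl => exact .refl
  | @tail b c _ hbc ih =>
    by_cases hne : b = c
    · exact hne ▸ ih
    · exact ih.tail (hrs _ _ hne hbc)

namespace WeightedDigraph

variable {V : Type*} (G : WeightedDigraph V)

theorem coe_mem_strongCycles {a w : V} {m : List V} :
    ((a :: (m ++ [w]) : List V) : Cycle V) ∈ G.strongCycles ↔
      (a :: (m ++ [w])).Nodup ∧ (a :: (m ++ [w])).IsChain G.Edge ∧ G.Edge w a := by
  simp only [strongCycles, Set.mem_ofPred_eq, Cycle.nodup_coe_iff, Cycle.chain_coe_cons,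
    Cycle.length_coe]
  have h : a :: (m ++ [w] ++ [a]) = (a :: m) ++ w :: a :: [] := by simp
  rw [h, List.isChain_append_cons_cons]
  simp

variable {G}

theorem exists_eq_of_mem_strongCycles {γ : Cycle V} (h : γ ∈ G.strongCycles) :
    ∃ (a : V) (m : List V) (w : V), γ = ((a :: (m ++ [w]) : List V) : Cycle V) := by
  induction γ using Quotient.inductionOn' with
  | h l =>
    have hl : 2 ≤ l.length := h.2.2
    match l, hl with
    | a :: b :: l, _ =>
      refine ⟨a, (b :: l).dropLast, (b :: l).getLast (by simp), ?_⟩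
      rw [List.dropLast_append_getLast]
      rfl

theorem sameComponent_of_mem_strongCycles {γ : Cycle V} (h : γ ∈ G.strongCycles) {x y : V}
    (hx : x ∈ γ) (hy : y ∈ γ) : G.SameComponent x y := by
  have hc : γ.Chain (Relation.TransGen G.Edge) :=
    Cycle.chain_mono (fun _ _ => Relation.TransGen.single) _ h.2.1
  rw [Cycle.chain_iff_pairwise] at hc
  exact ⟨(hc x hx y hy).to_reflTransGen, (hc y hy x hx).to_reflTransGen⟩

/-- Let `c` be the second vertex of a path from `i` to `j`. Then `c` reaches `i` by way of `j`, and
a path from `c` to `i` is closed by the edge from `i` to `c`. -/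
theorem exists_mem_strongCycles_of_sameComponent {i j : V} (hij : i ≠ j)
    (h : G.SameComponent i j) : ∃ γ ∈ G.strongCycles, i ∈ γ := by
  obtain ⟨l, hl, hc⟩ := h.1.exists_nodup_isChain hij
  obtain ⟨c, t, hct⟩ : ∃ c t, l ++ [j] = c :: t := by
    cases l with
    | nil => exact ⟨j, [], rfl⟩
    | cons c l => exact ⟨c, l ++ [j], rfl⟩
  rw [hct] at hl hc
  rw [List.isChain_cons_cons] at hc
  have hcj : Relation.ReflTransGen G.Edge c j := by
    refine List.relationReflTransGen_of_exists_isChain_cons t hc.2 ?_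
    simp [← hct]
  have hci : c ≠ i := by
    rintro rfl
    simp at hl
  obtain ⟨s, hs, hsc⟩ := (hcj.trans h.2).exists_nodup_isChain hci
  exact ⟨_, (G.coe_mem_strongCycles).2 ⟨hs, hsc, hc.1⟩, by simp⟩

theorem pair_mem_strongCycles {i j : V} (hij : i ≠ j) (h : G.Edge i j) (h' : G.Edge j i) :
    (([i, j] : List V) : Cycle V) ∈ G.strongCycles :=
  (G.coe_mem_strongCycles (m := [])).2 ⟨by simpa using hij, by simpa using h, h'⟩

/-- Consecutive vertices of a strong cycle are distinct, so loops, the only edges that the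
polynomial extension can create or destroy, play no role. -/
theorem strongCycles_subset_of_forall_ne {H : WeightedDigraph V}
    (h : ∀ i j, i ≠ j → G.Edge i j → H.Edge i j) : G.strongCycles ⊆ H.strongCycles := by
  intro γ hγ
  obtain ⟨a, m, w, rfl⟩ := exists_eq_of_mem_strongCycles hγ
  rw [coe_mem_strongCycles] at hγ ⊢
  obtain ⟨hn, hc, he⟩ := hγ
  refine ⟨hn, ?_, h _ _ ?_ he⟩
  · have hne : ∀ {l : List V}, l.Nodup → l.IsChain G.Edge → l.IsChain H.Edge := by
      intro l
      induction l with
      | nil => simp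
      | cons b l ih =>
        intro hn hc
        rw [List.isChain_cons] at hc ⊢
        rw [List.nodup_cons] at hn
        refine ⟨fun y hy => h _ _ ?_ (hc.1 y hy), ih hn.2 hc.2⟩
        rintro rfl
        exact hn.1 (List.mem_of_mem_head? hy)
    exact hne hn hc
  · rintro rfl
    simp at hn

variable (G) in
theorem exists_mem_cycleSet (i : V) : ∃ γ ∈ G.cycleSet, i ∈ γ := by
  by_cases h : ∃ γ ∈ G.strongCycles, i ∈ γ
  · obtain ⟨γ, hγ, hi⟩ := h
    exact ⟨γ, Or.inl hγ, hi⟩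
  · push Not at h
    exact ⟨_, Or.inr ⟨i, rfl, h⟩, by simp⟩

/-! ### The region in terms of normalised weights -/

section Finite

variable [Fintype V]

variable (G) in
theorem polyExt_strongCycles : G.polyExt.strongCycles = G.strongCycles :=
  (strongCycles_subset_of_forall_ne fun _ _ hij => (G.polyExt_edge_iff hij).1).antisymm
    (strongCycles_subset_of_forall_ne fun _ _ hij => (G.polyExt_edge_iff hij).2)

variable (G) in
theorem polyExt_sameComponent_iff {i j : V} :
    G.polyExt.SameComponent i j ↔ G.SameComponent i j :=
  ⟨fun h => ⟨h.1.of_forall_ne fun _ _ hij => (G.polyExt_edge_iff hij).1,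
      h.2.of_forall_ne fun _ _ hij => (G.polyExt_edge_iff hij).1⟩,
    fun h => ⟨h.1.of_forall_ne fun _ _ hij => (G.polyExt_edge_iff hij).2,
      h.2.of_forall_ne fun _ _ hij => (G.polyExt_edge_iff hij).2⟩⟩

open Classical in
variable (G) in
/-- For a complex matrix `b` the sum of the absolute values of the off-diagonal entries of row
`i`, restricted to the strongly connected component of `i`. -/
def matrixRowSum (b : V → V → ℂ) (i : V) : ℝ :=
  ∑ j with j ≠ i ∧ G.SameComponent i j, ‖b i j‖

theorem matrixRowSum_nonneg (b : V → V → ℂ) (i : V) : 0 ≤ G.matrixRowSum b i :=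
  Finset.sum_nonneg fun _ _ => norm_nonneg _

theorem norm_le_matrixRowSum (b : V → V → ℂ) {i j : V} (hij : j ≠ i)
    (h : G.SameComponent i j) : ‖b i j‖ ≤ G.matrixRowSum b i := by
  classical
  exact Finset.single_le_sum (f := fun j => ‖b i j‖) (fun _ _ => norm_nonneg _) (by simp [hij, h])

variable (G) in
/-- At `z` the off-diagonal weights have the values `a i j`, and the reciprocals of
`λ - ω(i, i)` have the values `u i`. -/
def HasValuesAt (z : ℂ) (u : V → ℂ) (a : V → V → ℂ) : Prop :=
  ∀ i, RatFunc.X - G.weight i i ≠ 0 ∧ HasValueAt (RatFunc.X - G.weight i i)⁻¹ z (u i) ∧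
    ∀ j, j ≠ i → HasValueAt (G.weight i j) z (a i j)

/-- Every vertex lies on some cycle, and a vanishing factor makes the left side of that cycle's
inequality `0`, which would put `z` into the region. -/
theorem exists_hasValuesAt {z : ℂ} (hz : z ∉ G.brualdiRegion) :
    ∃ u a, G.HasValuesAt z u a := by
  classical
  have key : ∀ i, z - G.polyExt.weightAt z i i ≠ 0 := by
    intro i hi
    obtain ⟨γ, hγ, hiγ⟩ := G.polyExt.exists_mem_cycleSet i
    refine hz (Set.mem_biUnion hγ ?_)
    rw [brualdiRegionOf, Set.mem_ofPred_eq, Finset.prod_eq_zero (i := i)]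
    · exact Finset.prod_nonneg fun _ _ => Finset.sum_nonneg fun _ _ => norm_nonneg _
    · induction γ using Quotient.inductionOn' with
      | h l => exact List.mem_toFinset.2 hiγ
    · simp [hi]
  refine ⟨fun i => (G.weight i i).denom.eval z / (G.diagNum i).eval z,
    fun i j => (G.weight i j).num.eval z / (G.weight i j).denom.eval z, fun i => ?_⟩
  have h := key i
  rw [sub_polyExt_weightAt_self] at h
  have h1 := left_ne_zero_of_mul h
  have h2 := (G.eval_rowDenomErase_ne_zero).1 (right_ne_zero_of_mul h)
  refine ⟨?_, G.hasValueAt_inv_X_sub_weight h1, fun j hj => HasValueAt.of_denom (h2 j hj)⟩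
  rw [X_sub_weight]
  exact div_ne_zero (HasValueAt.algebraMap_ne_zero_of_eval h1)
    (RatFunc.algebraMap_ne_zero (RatFunc.denom_ne_zero _))

/-- Away from the poles the Brualdi-type region can be described in terms of the quotients
`ω(i, j) / (λ - ω(i, i))`. -/
theorem HasValuesAt.mem_brualdiRegion_iff {z : ℂ} {u : V → ℂ} {a : V → V → ℂ}
    (h : G.HasValuesAt z u a) :
    z ∈ G.brualdiRegion ↔ ∃ l : List V, (l : Cycle V) ∈ G.strongCycles ∧
      1 ≤ (l.map (G.matrixRowSum fun i j => u i * a i j)).prod := by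
  classical
  have hc : ∀ i, 0 < ‖z - G.polyExt.weightAt z i i‖ := by
    intro i
    rw [norm_pos_iff, sub_polyExt_weightAt_self]
    refine mul_ne_zero (G.diagNum_eval_of_hasValueAt (h i).1 (h i).2.1).1 ?_
    exact (G.eval_rowDenomErase_ne_zero).2 fun j hj => ((h i).2.2 j hj).denom_eval.1
  have hr : ∀ i, G.polyExt.componentRowSum z i =
      ‖z - G.polyExt.weightAt z i i‖ * G.matrixRowSum (fun i j => u i * a i j) i := by
    intro i
    rw [componentRowSum, matrixRowSum, Finset.mul_sum]
    refine Finset.sum_congr (by simp only [polyExt_sameComponent_iff]) fun j hj => ?_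
    have hji : j ≠ i := (Finset.mem_filter.1 hj).2.1
    rw [G.polyExt_weightAt_eq_mul hji.symm (h i).1 (h i).2.1 ((h i).2.2 j hji), norm_mul]
  have hregion : ∀ γ : Cycle V, z ∈ G.brualdiRegionOf γ ↔
      1 ≤ ∏ i ∈ γ.toFinset, G.matrixRowSum (fun i j => u i * a i j) i := by
    intro γ
    rw [brualdiRegionOf, Set.mem_ofPred_eq]
    simp only [hr, Finset.prod_mul_distrib]
    exact le_mul_iff_one_le_right (Finset.prod_pos fun i _ => hc i)
  simp only [brualdiRegion, Set.mem_iUnion, hregion, exists_prop, cycleSet, polyExt_strongCycles]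
  constructor
  · rintro ⟨γ, hγ | ⟨i, rfl, hi⟩, hle⟩
    · induction γ using Quotient.inductionOn' with
      | h l =>
        refine ⟨l, hγ, ?_⟩
        have hle' : 1 ≤ ∏ i ∈ l.toFinset, G.matrixRowSum (fun i j => u i * a i j) i := hle
        rwa [List.prod_toFinset _ hγ.1] at hle'
    -- A vertex on no strong cycle is alone in its component, so its row sum is `0` and the
    -- inequality would read `1 ≤ 0`.
    · exfalso
      have h0 : G.matrixRowSum (fun i j => u i * a i j) i = 0 := by
        refine Finset.sum_eq_zero fun j hj => absurd hj ?_
        simp only [Finset.mem_filter, Finset.mem_univ, true_and, not_and]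
        intro hji hsame
        obtain ⟨γ, hγ, hiγ⟩ := exists_mem_strongCycles_of_sameComponent (Ne.symm hji) hsame
        rw [← polyExt_strongCycles] at hγ
        exact hi γ hγ hiγ
      simp [h0] at hle
      linarith
  · rintro ⟨l, hl, hle⟩
    refine ⟨l, Or.inl hl, ?_⟩
    rwa [Cycle.coe_toFinset, List.prod_toFinset _ (Cycle.nodup_coe_iff.1 hl.1)]

end Finite

end WeightedDigraph

/-! ### Removing one vertex: weights and row sums -/

namespace WeightedDigraph

variable {V : Type*} {G : WeightedDigraph V} [Fintype V] [DecidableEq V] {v : V}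

theorem coe_ne_of_compl_singleton (i : ({v}ᶜ : Finset V)) : (i : V) ≠ v := by
  have h := i.2
  rwa [Finset.mem_compl, Finset.mem_singleton] at h

variable (G) in
/-- The weights of the graph that is obtained by removing a single vertex. -/
theorem reduction_compl_singleton_weight (i j : ({v}ᶜ : Finset V)) :
    (G.reduction {v}ᶜ).weight i j =
      G.weight i j + G.weight i v * (RatFunc.X - G.weight v v)⁻¹ * G.weight v j := by
  -- An interior of distinct vertices outside the complement of `v` is empty or just `v`.
  -- Intersecting with the support absorbs the case that one of these two sequences is not a branch,
  -- since its product is then `0`.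
  have hbranch : G.branches {v}ᶜ i j ∩ Function.support G.branchProduct =
      {[(i : V), (j : V)], [(i : V), v, (j : V)]} ∩ Function.support G.branchProduct := by
    ext β
    simp only [Set.mem_inter_iff, Function.mem_support, and_congr_left_iff, Set.mem_insert_iff,
      Set.mem_singleton_iff]
    intro hβ
    constructor
    · rintro ⟨l, rfl, hl, hlv, -⟩
      match l with
      | [] => simp
      | [a] =>
        have ha : a = v := by simpa using hlv a (by simp)
        simp [ha]
      | a :: b :: l =>
        have ha : a = v := by simpa using hlv a (by simp)
        have hb : b = v := by simpa using hlv b (by simp)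
        simp [ha, hb] at hl
    · rintro (rfl | rfl)
      · refine ⟨[], rfl, by simp, by simp, ?_⟩
        simp only [branchProduct, interiorProduct, mul_one] at hβ
        simpa [Edge] using hβ
      · refine ⟨[v], rfl, by simp, by simp, ?_⟩
        simp only [branchProduct, interiorProduct, mul_one] at hβ
        simp only [List.isChain_cons_cons, List.isChain_singleton, and_true]
        refine ⟨left_ne_zero_of_mul hβ, ?_⟩
        have := right_ne_zero_of_mul hβ
        intro h0
        simp [h0] at this
  change ∑ᶠ β ∈ G.branches {v}ᶜ i j, G.branchProduct β = _
  rw [← finsum_mem_inter_support, hbranch, finsum_mem_inter_support,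
    finsum_mem_pair (by simp)]
  simp only [branchProduct, interiorProduct, mul_one, div_eq_mul_inv]
  ring

theorem edge_or_of_reduction_edge {i j : ({v}ᶜ : Finset V)}
    (h : (G.reduction {v}ᶜ).Edge i j) :
    G.Edge i j ∨ G.Edge i v ∧ G.Edge v j := by
  rw [Edge, reduction_compl_singleton_weight] at h
  by_contra! hcon
  obtain ⟨h1, h2⟩ := hcon
  simp only [Edge, ne_eq, not_not] at h1 h2
  by_cases h3 : G.weight i v = 0
  · simp [h1, h3] at h
  · simp [h1, h2 h3] at h

theorem reflTransGen_of_reduction {i j : ({v}ᶜ : Finset V)}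
    (h : Relation.ReflTransGen (G.reduction {v}ᶜ).Edge i j) :
    Relation.ReflTransGen G.Edge i j := by
  induction h with
  | refl => exact .refl
  | tail _ hbc ih =>
    rcases edge_or_of_reduction_edge hbc with h | ⟨h, h'⟩
    · exact ih.tail h
    · exact (ih.tail h).tail h'

theorem sameComponent_of_reduction {i j : ({v}ᶜ : Finset V)}
    (h : (G.reduction {v}ᶜ).SameComponent i j) : G.SameComponent i j :=
  ⟨reflTransGen_of_reduction h.1, reflTransGen_of_reduction h.2⟩

/-- The values of the weights of the reduced graph. -/
theorem HasValuesAt.reduction {z : ℂ} {u : V → ℂ} {a : V → V → ℂ} (h : G.HasValuesAt z u a)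
    (hv : ∀ i, i ≠ v → 1 - u i * a i v * (u v * a v i) ≠ 0) :
    (G.reduction {v}ᶜ).HasValuesAt z
      (fun i => u i * (1 - u i * a i v * (u v * a v i))⁻¹)
      (fun i j => a i j + a i v * u v * a v j) := by
  intro i
  have hi := coe_ne_of_compl_singleton i
  obtain ⟨h0, hu, ha⟩ := h i
  obtain ⟨-, huv, hav⟩ := h v
  have hg := HasValueAt.one.sub ((hu.mul (ha v hi.symm)).mul (huv.mul (hav i hi)))
  -- The new diagonal term factors through the old one, so again no value of `ω(i, i)` itself is
  -- needed.
  have hfac : RatFunc.X - (G.reduction {v}ᶜ).weight i i = (RatFunc.X - G.weight i i) *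
      (1 - (RatFunc.X - G.weight i i)⁻¹ * G.weight i v *
        ((RatFunc.X - G.weight v v)⁻¹ * G.weight v i)) := by
    rw [reduction_compl_singleton_weight, mul_sub, mul_one, ← mul_assoc, ← mul_assoc, ← mul_assoc,
      mul_inv_cancel₀ h0]
    ring
  refine ⟨?_, ?_, fun j hj => ?_⟩
  · rw [hfac]
    exact mul_ne_zero h0 (hg.ne_zero (hv i hi))
  · rw [hfac, mul_inv]
    exact hu.mul (hg.inv (hv i hi))
  · have hj' := coe_ne_of_compl_singleton j
    rw [reduction_compl_singleton_weight]
    exact (ha j fun h => hj (Subtype.ext h)).add (((ha v hi.symm).mul huv).mul (hav j hj'))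

/-- A row sum in the reduced graph is at most the sum of the same absolute values over the
component in the original graph. -/
theorem reduction_matrixRowSum_le_sum {b : ({v}ᶜ : Finset V) → ({v}ᶜ : Finset V) → ℂ}
    {i : ({v}ᶜ : Finset V)} {f : V → ℝ} (t : Finset V) (hf : ∀ j ∈ t, 0 ≤ f j)
    (ht : ∀ j : ({v}ᶜ : Finset V), j ≠ i → G.SameComponent i j → (j : V) ∈ t)
    (hb : ∀ j : ({v}ᶜ : Finset V), j ≠ i → (G.reduction {v}ᶜ).SameComponent i j →
      ‖b i j‖ ≤ f j) :
    (G.reduction {v}ᶜ).matrixRowSum b i ≤ ∑ j ∈ t, f j := by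
  classical
  calc (G.reduction {v}ᶜ).matrixRowSum b i
      ≤ ∑ j : ({v}ᶜ : Finset V) with j ≠ i ∧ (G.reduction {v}ᶜ).SameComponent i j, f j := by
        rw [matrixRowSum]
        refine (Finset.sum_le_sum fun j hj => ?_).trans_eq (Finset.sum_congr (by congr) fun _ _ => rfl)
        simp only [Finset.mem_filter, Finset.mem_univ, true_and] at hj
        exact hb j hj.1 hj.2
    _ = ∑ j ∈ (Finset.univ.filter fun j : ({v}ᶜ : Finset V) =>
          j ≠ i ∧ (G.reduction {v}ᶜ).SameComponent i j).map (Function.Embedding.subtype _), f j := by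
        rw [Finset.sum_map]
        rfl
    _ ≤ _ := by
        refine Finset.sum_le_sum_of_subset_of_nonneg ?_ fun j hj _ => hf j hj
        intro j hj
        simp only [Finset.mem_map, Finset.mem_filter, Finset.mem_univ, true_and] at hj
        obtain ⟨k, ⟨hk, hk'⟩, rfl⟩ := hj
        exact ht k hk (sameComponent_of_reduction hk')

/-- The matrix of the quotients `ω(i, j) / (λ - ω(i, i))` of the reduced graph in terms of the same
matrix `b` of the original graph. -/
def reducedMatrix (v : V) (b : V → V → ℂ) (i j : ({v}ᶜ : Finset V)) : ℂ :=
  (b i j + b i v * b v j) / (1 - b i v * b v i)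

variable {b : V → V → ℂ}

/-- A nonzero `b i v * b v j` with `j` in the component of `i` would give a closed walk through `i`,
`v`, `j`, making `(i, v)` a component edge. So the detour terms vanish; for `j = i` this makes the
denominator `1`. -/
theorem reduction_matrixRowSum_le (hb : ∀ i j, i ≠ j → b i j ≠ 0 → G.Edge i j)
    {i : ({v}ᶜ : Finset V)} (hi : ¬ G.ComponentEdge i v) :
    (G.reduction {v}ᶜ).matrixRowSum (reducedMatrix v b) i ≤ G.matrixRowSum b i := by
  classical
  have hiv := coe_ne_of_compl_singleton i
  have key : ∀ j : V, j ≠ v → G.SameComponent i j → b i v * b v j = 0 := by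
    intro j hjv hij
    by_contra hne
    have h1 := hb _ _ hiv (left_ne_zero_of_mul hne)
    have h2 := hb _ _ hjv.symm (right_ne_zero_of_mul hne)
    exact hi ⟨h1, .single h1, (Relation.ReflTransGen.single h2).trans hij.2⟩
  refine reduction_matrixRowSum_le_sum _ (fun _ _ => norm_nonneg _) (fun j hj hij => ?_)
    fun j hj hij => ?_
  · simp only [Finset.mem_filter, Finset.mem_univ, true_and]
    exact ⟨fun h => hj (Subtype.ext h), hij⟩
  · rw [reducedMatrix, key j (coe_ne_of_compl_singleton j) (sameComponent_of_reduction hij),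
      key i hiv ⟨.refl, .refl⟩]
    simp

/-- All direct terms `b i j` vanish. With `x = |b i v|`, `y = |b v i|` and `s = ρ v`, the row sum is
at most `x (s - y) / (1 - x y)`, which is at most `x s` because `y (1 - x s) ≥ 0`. -/
theorem reduction_matrixRowSum_le_mul (hb : ∀ i j, i ≠ j → b i j ≠ 0 → G.Edge i j)
    {i : ({v}ᶜ : Finset V)} (hi : G.ComponentEdge i v)
    (honly : ∀ j : V, j ≠ i → j ≠ v → ¬ G.ComponentEdge i j)
    (hlt : G.Edge v i → G.matrixRowSum b i * G.matrixRowSum b v < 1) :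
    (G.reduction {v}ᶜ).matrixRowSum (reducedMatrix v b) i ≤
      G.matrixRowSum b i * G.matrixRowSum b v := by
  classical
  have hiv := coe_ne_of_compl_singleton i
  have hsame := hi.2
  have hx := G.norm_le_matrixRowSum b hiv.symm hsame
  have hy := G.norm_le_matrixRowSum b hiv ⟨hsame.2, hsame.1⟩
  set r := G.matrixRowSum b i
  set s := G.matrixRowSum b v with hs
  have hs0 : 0 ≤ s := matrixRowSum_nonneg _ _
  have hx0 := norm_nonneg (b i v)
  have hy0 := norm_nonneg (b v i)
  -- Either there is no edge back from `v`, or `i` and `v` form a strong 2-cycle.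
  have hxs : ‖b v i‖ = 0 ∨ r * s < 1 := by
    by_cases h : b v i = 0
    · simp [h]
    · exact Or.inr (hlt (hb _ _ hiv.symm h))
  have hxy : ‖b i v‖ * ‖b v i‖ < 1 := by
    rcases hxs with h | h
    · simp [h]
    · exact (mul_le_mul hx hy hy0 (hx0.trans hx)).trans_lt h
  have hden : 1 - ‖b i v‖ * ‖b v i‖ ≤ ‖1 - b i v * b v i‖ := by
    have := norm_sub_norm_le 1 (b i v * b v i)
    simpa using this
  have hpos : 0 < 1 - ‖b i v‖ * ‖b v i‖ := by linarith
  let t : Finset V := (Finset.univ.filter fun j => j ≠ v ∧ G.SameComponent v j).erase i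
  have hsum : ∑ j ∈ t, ‖b v j‖ = s - ‖b v i‖ := by
    have hmem : (i : V) ∈ Finset.univ.filter fun j => j ≠ v ∧ G.SameComponent v j :=
      Finset.mem_filter.2 ⟨Finset.mem_univ _, hiv, hsame.2, hsame.1⟩
    rw [eq_sub_iff_add_eq, hs, matrixRowSum, Finset.sum_erase_add _ (fun j => ‖b v j‖) hmem]
    exact Finset.sum_congr (by congr) fun _ _ => rfl
  calc _ ≤ ∑ j ∈ t, ‖b i v‖ / (1 - ‖b i v‖ * ‖b v i‖) * ‖b v j‖ := by
        refine reduction_matrixRowSum_le_sum t (fun j _ => by positivity) (fun j hj hij => ?_)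
          fun j hj hij => ?_
        · simp only [t, Finset.mem_erase, Finset.mem_filter, Finset.mem_univ, true_and]
          exact ⟨fun h => hj (Subtype.ext h), coe_ne_of_compl_singleton j,
            hsame.2.trans hij.1, hij.2.trans hsame.1⟩
        · have hj' : (j : V) ≠ i := fun h => hj (Subtype.ext h)
          have hbij : b i j = 0 := by
            by_contra h0
            exact honly j hj' (coe_ne_of_compl_singleton j)
              ⟨hb _ _ hj'.symm h0, sameComponent_of_reduction hij⟩
          rw [reducedMatrix, hbij, zero_add, norm_div, norm_mul, div_mul_eq_mul_div]
          gcongr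
    _ = ‖b i v‖ / (1 - ‖b i v‖ * ‖b v i‖) * (s - ‖b v i‖) := by rw [← Finset.mul_sum, hsum]
    _ ≤ ‖b i v‖ * s := by
        rw [div_mul_eq_mul_div, div_le_iff₀ hpos]
        have : 0 ≤ ‖b v i‖ * (1 - ‖b i v‖ * s) := by
          rcases hxs with h | h
          · simp [h]
          · have := mul_le_mul_of_nonneg_right hx hs0
            exact mul_nonneg hy0 (by linarith)
        nlinarith [mul_nonneg hx0 this]
    _ ≤ r * s := by gcongr

end WeightedDigraph

/-! ### Cutting cycles of the reduction at detours through `v` -/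

theorem List.exists_append_of_not_isChain {α : Type*} {r : α → α → Prop} {l : List α}
    (h : ¬ l.IsChain r) : ∃ (s t : List α) (a b : α), l = s ++ a :: b :: t ∧ ¬ r a b := by
  induction l with
  | nil => simp at h
  | cons x l ih =>
    cases l with
    | nil => simp at h
    | cons y l =>
      rw [List.isChain_cons_cons, not_and_or] at h
      rcases h with h | h
      · exact ⟨[], l, x, y, rfl, h⟩
      · obtain ⟨s, t, a, b, he, hab⟩ := ih h
        exact ⟨x :: s, t, a, b, by rw [he]; rfl, hab⟩

namespace WeightedDigraph

variable {V : Type*} {G : WeightedDigraph V} {v : V}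

theorem not_componentEdge_of_adjacentCycles_eq_empty (hA : G.adjacentCycles v = ∅) {γ : Cycle V}
    (hγ : γ ∈ G.strongCycles) (hv : v ∉ γ) {j : V} (hj : j ∈ γ) : ¬ G.ComponentEdge j v := by
  intro h
  have : γ ∈ G.adjacentCycles v := ⟨Or.inl hγ, hv, j, hj, h⟩
  rw [hA] at this
  exact this

/-- On a cycle `v, m, w` only `w` has an edge to `v`, and that is the only edge from `w` that
belongs to a strongly connected component and is not a loop. -/
theorem edges_of_special_cycle (hA : G.adjacentCycles v = ∅)
    (hS : G.cyclesThrough v = G.specialCycles v) {m : List V} {w : V}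
    (hγ : ((v :: (m ++ [w]) : List V) : Cycle V) ∈ G.strongCycles) :
    (∀ x ∈ m, ¬ G.Edge x v) ∧ ∀ j, j ≠ w → j ≠ v → ¬ G.ComponentEdge w j := by
  have hmem : ((v :: (m ++ [w]) : List V) : Cycle V) ∈ G.specialCycles v := by
    rw [← hS]
    exact ⟨Or.inl hγ, by simp⟩
  obtain ⟨hm, hw⟩ := hmem.2 m w rfl
  refine ⟨hm, fun j hjw hjv hwj => ?_⟩
  -- A chord from `w` back to `j` in `m` would close a strong cycle that avoids `v` but contains
  -- `w`, contradicting `hA`.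
  by_cases hj : j ∈ m
  · obtain ⟨s, t, rfl⟩ := List.append_of_mem hj
    have hsame : G.SameComponent w v := sameComponent_of_mem_strongCycles hγ (by simp) (by simp)
    obtain ⟨hn, hc, hwv⟩ := (G.coe_mem_strongCycles).1 hγ
    have he : v :: (s ++ j :: t ++ [w]) = (v :: s) ++ (j :: (t ++ [w])) := by simp
    rw [he] at hn hc
    have hδ : ((j :: (t ++ [w]) : List V) : Cycle V) ∈ G.strongCycles :=
      (G.coe_mem_strongCycles).2 ⟨(List.nodup_append.1 hn).2.1, hc.right_of_append, hwj.1⟩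
    refine not_componentEdge_of_adjacentCycles_eq_empty hA hδ ?_ (j := w) (by simp) ⟨hwv, hsame⟩
    intro hv
    exact (List.nodup_append.1 hn).2.2 v (by simp) v (by simpa using hv) rfl
  · exact hw j (by simpa [hjv, hjw] using hj) hwj

variable [Fintype V] [DecidableEq V] {ρ : V → ℝ} {ρ' : ({v}ᶜ : Finset V) → ℝ}

/-- Along a walk of the reduced graph that starts at an out-neighbour of `v` and ends at an
in-neighbour of `v`, the product of the bounds `ρ'` is less than `1`. -/
theorem prod_lt_one_of_closed_through (hA : G.adjacentCycles v = ∅)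
    (hS : G.cyclesThrough v = G.specialCycles v) (hρ' : ∀ i, 0 ≤ ρ' i)
    (hlt : ∀ l : List V, (l : Cycle V) ∈ G.strongCycles → (l.map ρ).prod < 1)
    (hle : ∀ i : ({v}ᶜ : Finset V), ¬ G.ComponentEdge i v → ρ' i ≤ ρ i)
    (hmul : ∀ i : ({v}ᶜ : Finset V), G.ComponentEdge i v →
      (∀ j : V, j ≠ i → j ≠ v → ¬ G.ComponentEdge i j) → ρ' i ≤ ρ i * ρ v)
    (a : ({v}ᶜ : Finset V)) (m : List ({v}ᶜ : Finset V)) (ha : G.Edge v a)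
    (hn : (a :: m).Nodup) (hc : (a :: m).IsChain (G.reduction {v}ᶜ).Edge)
    (hl : G.Edge ((a :: m).getLast (List.cons_ne_nil _ _)) v) :
    ((a :: m).map ρ').prod < 1 := by
  by_cases hdirect : (a :: m).IsChain fun x y : ({v}ᶜ : Finset V) => G.Edge x y
  · obtain ⟨s, w, hsw⟩ : ∃ s w, a :: m = s ++ [w] :=
      ⟨_, _, (List.dropLast_append_getLast (List.cons_ne_nil a m)).symm⟩
    have hwv : G.Edge w v := by simpa [hsw] using hl
    have hγ : ((v :: (s.map Subtype.val ++ [(w : V)]) : List V) : Cycle V) ∈ G.strongCycles := by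
      have he : s.map Subtype.val ++ [(w : V)] = (a :: m).map Subtype.val := by simp [hsw]
      rw [coe_mem_strongCycles, he]
      refine ⟨List.nodup_cons.2 ⟨?_, hn.map Subtype.val_injective⟩, ?_, hwv⟩
      · rw [List.mem_map]
        rintro ⟨x, -, hx⟩
        exact coe_ne_of_compl_singleton x hx
      · rw [List.map_cons, List.isChain_cons_cons]
        exact ⟨ha, (List.isChain_map Subtype.val (l := a :: m)).2 hdirect⟩
    obtain ⟨h1, h2⟩ := edges_of_special_cycle hA hS hγ
    have hw : ρ' w ≤ ρ w * ρ v :=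
      hmul w ⟨hwv, sameComponent_of_mem_strongCycles hγ (by simp) (by simp)⟩ h2
    have hs : (s.map ρ').prod ≤ (s.map fun i : ({v}ᶜ : Finset V) => ρ i).prod :=
      List.prod_map_le_prod_map₀ _ _ (fun i _ => hρ' i) fun i hi =>
        hle i fun h => h1 i (List.mem_map_of_mem hi) h.1
    have hs0 : 0 ≤ (s.map ρ').prod := 
      List.prod_nonneg (by simp only [List.mem_map]; rintro _ ⟨i, -, rfl⟩; exact hρ' i)
    calc ((a :: m).map ρ').prod = (s.map ρ').prod * ρ' w := by simp [hsw]
      _ ≤ (s.map fun i : ({v}ᶜ : Finset V) => ρ i).prod * (ρ w * ρ v) :=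
          mul_le_mul hs hw (hρ' w) (hs0.trans hs)
      _ = ((v :: (s.map Subtype.val ++ [(w : V)])).map ρ).prod := by
          simp
          ring
      _ < 1 := hlt _ hγ
  -- The step from `x` to `y` is a detour through `v`, so both halves again run from an
  -- out-neighbour to an in-neighbour of `v`, and both are shorter.
  · obtain ⟨s, t, x, y, he, hxy⟩ := List.exists_append_of_not_isChain hdirect
    obtain ⟨m', hm'⟩ : ∃ m', s ++ [x] = a :: m' := by
      cases s with
      | nil => exact ⟨[], by simp_all⟩
      | cons c s => exact ⟨s ++ [x], by simp_all⟩
    have he' : a :: m = (a :: m') ++ (y :: t) := by rw [he, ← hm']; simp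
    have hc' := hc
    rw [he, List.isChain_append_cons_cons, hm'] at hc'
    obtain ⟨hxv, hvy⟩ := (edge_or_of_reduction_edge hc'.2.1).resolve_left hxy
    have hn' := hn
    rw [he', List.nodup_append] at hn'
    have h1 := prod_lt_one_of_closed_through hA hS hρ' hlt hle hmul a m' ha hn'.1 hc'.1
      (by simpa [← hm'] using hxv)
    have h2 := prod_lt_one_of_closed_through hA hS hρ' hlt hle hmul y t hvy hn'.2.1 hc'.2.2
      (by simpa [he'] using hl)
    rw [he', List.map_append, List.prod_append]
    refine mul_lt_one_of_nonneg_of_lt_one_left ?_ h1 h2.le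
    exact List.prod_nonneg (by simp only [List.mem_map]; rintro _ ⟨i, -, rfl⟩; exact hρ' i)
termination_by m.length
decreasing_by
  all_goals
    have := congrArg List.length he'
    simp at this
    omega

theorem prod_lt_one_of_mem_reduction_strongCycles (hA : G.adjacentCycles v = ∅)
    (hS : G.cyclesThrough v = G.specialCycles v) (hρ' : ∀ i, 0 ≤ ρ' i)
    (hlt : ∀ l : List V, (l : Cycle V) ∈ G.strongCycles → (l.map ρ).prod < 1)
    (hle : ∀ i : ({v}ᶜ : Finset V), ¬ G.ComponentEdge i v → ρ' i ≤ ρ i)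
    (hmul : ∀ i : ({v}ᶜ : Finset V), G.ComponentEdge i v →
      (∀ j : V, j ≠ i → j ≠ v → ¬ G.ComponentEdge i j) → ρ' i ≤ ρ i * ρ v)
    {l : List ({v}ᶜ : Finset V)} (hl : (l : Cycle _) ∈ (G.reduction {v}ᶜ).strongCycles) :
    (l.map ρ').prod < 1 := by
  by_cases hG : ((l.map Subtype.val : List V) : Cycle V) ∈ G.strongCycles
  · have hv : v ∉ ((l.map Subtype.val : List V) : Cycle V) := by
      rw [Cycle.mem_coe_iff, List.mem_map]
      rintro ⟨x, -, hx⟩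
      exact coe_ne_of_compl_singleton x hx
    refine lt_of_le_of_lt ?_ (hlt _ hG)
    rw [List.map_map]
    exact List.prod_map_le_prod_map₀ _ _ (fun i _ => hρ' i) fun i hi => hle i
      (not_componentEdge_of_adjacentCycles_eq_empty hA hG hv (List.mem_map_of_mem hi))
  · obtain ⟨a, m, w, he⟩ := exists_eq_of_mem_strongCycles hl
    have hperm := (Cycle.coe_eq_coe.1 he).perm
    rw [he, coe_mem_strongCycles] at hl
    obtain ⟨hn, hc, hwa⟩ := hl
    have hmap : ((l.map Subtype.val : List V) : Cycle V) =
        (((a : V) :: (m.map Subtype.val ++ [(w : V)]) : List V) : Cycle V) := by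
      have := congrArg (Cycle.map Subtype.val) he
      simpa using this
    rw [(hperm.map ρ').prod_eq]
    have hn' : ((a : V) :: (m.map Subtype.val ++ [(w : V)])).Nodup := by
      simpa using hn.map Subtype.val_injective
    rw [hmap, coe_mem_strongCycles, not_and, not_and_or] at hG
    by_cases hwa' : G.Edge w a
    · have hdirect : ¬ (a :: (m ++ [w])).IsChain fun x y : ({v}ᶜ : Finset V) => G.Edge x y := by
        intro h
        have h' := (List.isChain_map Subtype.val (R := G.Edge)).2 h
        rcases hG hn' with h1 | h1
        · exact h1 (by simpa using h')
        · exact h1 hwa'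
      obtain ⟨s, t, x, y, hst, hxy⟩ := List.exists_append_of_not_isChain hdirect
      obtain ⟨m', hm'⟩ : ∃ m', s ++ [x] = a :: m' := by
        cases s with
        | nil => exact ⟨[], by simp_all⟩
        | cons c s => exact ⟨s ++ [x], by simp_all⟩
      obtain ⟨t', ht'⟩ : ∃ t', y :: t = t' ++ [w] := by
        have hlast := congrArg List.getLast? hst
        simp only [List.getLast?_append, List.getLast?_cons] at hlast
        refine ⟨(y :: t).dropLast, ?_⟩
        conv_lhs => rw [← List.dropLast_append_getLast (List.cons_ne_nil y t)]
        congr 2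
        simpa [List.getLast_eq_getLastD, eq_comm] using hlast
      have he' : a :: (m ++ [w]) = (s ++ [x]) ++ (y :: t) := by rw [hst]; simp
      have hcc := hc
      rw [hst, List.isChain_append_cons_cons] at hcc
      obtain ⟨hxv, hvy⟩ := (edge_or_of_reduction_edge hcc.2.1).resolve_left hxy
      -- The cycle is rotated to start right after the detour; the former closing edge from `w` to
      -- `a` becomes an interior step.
      have hp : (a :: (m ++ [w])).Perm (y :: (t ++ (s ++ [x]))) := by
        rw [he']
        exact List.perm_append_comm
      rw [(hp.map ρ').prod_eq]
      refine prod_lt_one_of_closed_through hA hS hρ' hlt hle hmul y _ hvy (hp.nodup_iff.1 hn) ?_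
        (by simpa using hxv)
      have : y :: (t ++ (s ++ [x])) = t' ++ w :: a :: m' := by
        rw [hm', ← List.cons_append, ht']
        simp
      rw [this, List.isChain_append_cons_cons, ← ht', ← hm']
      exact ⟨hcc.2.2, hwa, hcc.1⟩
    -- Here the closing edge is itself a detour, so no rotation is needed.
    · obtain ⟨hwv, hva⟩ := (edge_or_of_reduction_edge hwa).resolve_left hwa'
      exact prod_lt_one_of_closed_through hA hS hρ' hlt hle hmul a _ hva hn hc (by simpa using hwv)

theorem isStructuralSet_compl_singleton (hG : G.InGPi) (hV : 2 ≤ Fintype.card V) (v : V) :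
    G.IsStructuralSet {v}ᶜ := by
  refine ⟨?_, ?_, ?_⟩
  · rw [← Finset.card_pos, Finset.card_compl, Finset.card_singleton]
    omega
  · intro γ hγ
    obtain ⟨a, m, w, rfl⟩ := exists_eq_of_mem_strongCycles hγ
    have hn := ((G.coe_mem_strongCycles).1 hγ).1
    by_cases ha : a = v
    · refine ⟨w, by simp, ?_⟩
      rw [Finset.mem_compl, Finset.mem_singleton]
      rintro rfl
      simp [ha] at hn
    · exact ⟨a, by simp, by simpa using ha⟩
  -- The weight `λ` has degree `1`, which the degree condition forbids.
  · intro i _ h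
    have := hG i i
    rw [h, RatFunc.intDegree_X] at this
    omega

end WeightedDigraph

end

theorem theorem10 {V : Type*} [Fintype V] [DecidableEq V] (G : WeightedDigraph V)
    (hG : G.InGPi) (hV : 2 ≤ Fintype.card V) (v : V)
    (hA : G.adjacentCycles v = ∅) (hS : G.cyclesThrough v = G.specialCycles v) :
    G.IsStructuralSet {v}ᶜ ∧
      (G.reduction {v}ᶜ).brualdiRegion ⊆ G.brualdiRegion := by
  refine ⟨WeightedDigraph.isStructuralSet_compl_singleton hG hV v, fun z hz => ?_⟩
  by_contra hzG
  obtain ⟨u, a, ha⟩ := WeightedDigraph.exists_hasValuesAt hzG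
  set b : V → V → ℂ := fun i j => u i * a i j with hbdef
  have hb : ∀ i j, i ≠ j → b i j ≠ 0 → G.Edge i j := by
    intro i j hij h h0
    have h1 := (ha i).2.2 j hij.symm
    rw [h0] at h1
    exact h (by simp [hbdef, h1.eq_zero])
  have hlt : ∀ l : List V, (l : Cycle V) ∈ G.strongCycles →
      (l.map (G.matrixRowSum b)).prod < 1 := by
    rw [ha.mem_brualdiRegion_iff] at hzG
    push Not at hzG
    exact hzG
  have hpair : ∀ i, i ≠ v → G.Edge i v → G.Edge v i →
      G.matrixRowSum b i * G.matrixRowSum b v < 1 := by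
    intro i hi h h'
    simpa using hlt _ (WeightedDigraph.pair_mem_strongCycles hi h h')
  -- If `b i v * b v i = 1`, then `i` and `v` form a strong cycle whose row sums have product at
  -- least `1`, contradicting the choice of `z`.
  have hden : ∀ i, i ≠ v → 1 - u i * a i v * (u v * a v i) ≠ 0 := by
    intro i hi h0
    have h1 : b i v * b v i = 1 := (sub_eq_zero.1 h0).symm
    have h2 : b i v ≠ 0 ∧ b v i ≠ 0 := by
      constructor <;> intro h <;> simp [h] at h1
    have hiv := hb _ _ hi h2.1
    have hvi := hb _ _ hi.symm h2.2
    have hx := G.norm_le_matrixRowSum b hi.symm ⟨.single hiv, .single hvi⟩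
    have hy := G.norm_le_matrixRowSum b hi ⟨.single hvi, .single hiv⟩
    have h3 := mul_le_mul hx hy (norm_nonneg _) ((norm_nonneg _).trans hx)
    rw [← norm_mul, h1, norm_one] at h3
    exact absurd (hpair i hi hiv hvi) (not_lt.2 h3)
  rw [(ha.reduction hden).mem_brualdiRegion_iff] at hz
  obtain ⟨l, hl, hle⟩ := hz
  refine absurd hle (not_le.2 ?_)
  have hmat : (fun i j : ({v}ᶜ : Finset V) => u i * (1 - u i * a i v * (u v * a v i))⁻¹ *
      (a i j + a i v * u v * a v j)) = WeightedDigraph.reducedMatrix v b := by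
    funext i j
    simp only [WeightedDigraph.reducedMatrix, hbdef, div_eq_mul_inv]
    ring
  rw [hmat]
  refine WeightedDigraph.prod_lt_one_of_mem_reduction_strongCycles hA hS
    (fun i => WeightedDigraph.matrixRowSum_nonneg _ _) hlt
    (fun i hi => WeightedDigraph.reduction_matrixRowSum_le hb hi)
    (fun i hi honly => WeightedDigraph.reduction_matrixRowSum_le_mul hb hi honly fun h =>
      hpair i (WeightedDigraph.coe_ne_of_compl_singleton i) hi.1 h) hl
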